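/- Let $k\ge 1$, let $S$ be a countably infinite set, and let $K=(K_0,K_1,\dots,K_k)$ be a $k$-palette, that is, a sequence of standard Borel spaces. Write $\binom{S}{i}$ for the set of $i$-element subsets of $S$ and $$K^{(S)} := K_0\times K_1^{S}\times K_2^{\binom S2}\times\cdots\times K_k^{\binom Sk}$$ with its product $\sigma$-algebra. Let $\mu$ be an exchangeable random $K$-coloured hypergraph on $S$: a probability measure on $K^{(S)}$ that is invariant under the maps $\tau^g\big((\omega_e)_{e}\big)=(\omega_{g(e)})_{e}$ for all finitely supported permutations $g$ of $S$, where $e$ ranges over the subsets of $S$ of size at most $k$. Then there are standard Borel spaces $Z_0,\dots,Z_{k-1}$, a probability measure $\mu_0$ on $Z_0$, Borel maps $\kappa_i:Z_i\to K_i$ for $0\le i\le k-1$ and, with $Z_k:=K_k$, probability kernels $$P_i: Z_0\times Z_1^{i}\times Z_2^{\binom i2}\times\cdots\times Z_{i-1}^{\binom{i}{i-1}}\rightsquigarrow Z_i\qquad (1\le i\le k),$$ each invariant under the coordinate-permuting action of $\mathrm{Sym}(\{1,\dots,i\})$ on its domain, such that $\mu$ is the law of the random element $(\omega_e)_e$ of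 $K^{(S)}$ produced by the following procedure (the standard recipe): - choose $z_\emptyset\in Z_0$ with law $\mu_0$ and set $\omega_\emptyset:=\kappa_0(z_\emptyset)$; - for $i=1,\dots,k-1$ in turn, conditionally on the colours $z_a$ already chosen for all $a\subset S$ with $|a|<i$, choose the colours $z_u\in Z_i$, $u\in\binom Si$, independently, $z_u$ having law $P_i\big(z_\emptyset,(z_s)_{s\in u},\dots,(z_v)_{v\in\binom{u}{i-1}},\,\cdot\,\big)$, and set $\omega_u:=\kappa_i(z_u)$; - finally, conditionally on all colours $z_a$ with $|a|<k$, choose the colours $\omega_e\in K_k$, $e\in\binom Sk$, independently, $\omega_e$ having law $P_k\big(z_\emptyset,(z_s)_{s\in e},\dots,(z_u)_{u\in\binom{e}{k-1}},\,\cdot\,\big)$. -/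

import Mathlib

open MeasureTheory ProbabilityTheory

namespace ExchHypergraph

universe u v w

/-- The space `Z_0 × Z_1^T × Z_2^(T choose 2) × ⋯ × Z_{m-1}^(T choose (m-1))` of hypergraphs on the
vertex set `T`, with every `i`-subset of `T`, `i < m`, coloured by a point of `Z i`; it carries the
product σ-algebra. Only `Z 0, …, Z (m-1)` matter. For a `k`-palette `K = (K_0, …, K_k)`, the space
`K^(S)` of all `K`-coloured hypergraphs on `S` is `Colouring K (k + 1) S`. -/
abbrev Colouring (Z : ℕ → Type u) (m : ℕ) (T : Type v) : Type (max u v) :=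
  (i : Fin m) → Set.powersetCard T (i : ℕ) → Z i

section Basic

variable {Z : ℕ → Type u} {m : ℕ} {T : Type v} {S : Type w}

/-- The colouring of `T` induced from a colouring of `S` by an injection `f : T ↪ S`: the set `a`
receives the colour of `f(a)`. For a permutation `g` of `S` this is the coordinate-permuting map
`τ^g((ω_e)_e) = (ω_{g(e)})_e`. -/
def pullback (f : T ↪ S) (ω : Colouring Z m S) : Colouring Z m T :=
  fun i a => ω i (Set.powersetCard.map (i : ℕ) f a)

/-- An enumeration `e = {s_0, …, s_{i-1}}` of the elements of an `i`-subset `e` of `S`. Which one is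
chosen is immaterial below, by `IsSymmetricKernel.pullback_eq`. -/
noncomputable def enum {i : ℕ} (e : Set.powersetCard S i) : Fin i ↪ S :=
  (Set.powersetCard.ofFinEmb_surjective i S e).choose

lemma ofFinEmb_enum {i : ℕ} (e : Set.powersetCard S i) :
    Set.powersetCard.ofFinEmb i S (enum e) = e :=
  (Set.powersetCard.ofFinEmb_surjective i S e).choose_spec

/-- Adding the colours of the `m`-subsets to a colouring of all subsets of size less than `m`. -/
def extend (p : Colouring Z m S × (Set.powersetCard S m → Z m)) : Colouring Z (m + 1) S :=
  Fin.snoc (α := fun i : Fin (m + 1) => Set.powersetCard S (i : ℕ) → Z i) p.1 p.2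

variable [∀ i, MeasurableSpace (Z i)]

lemma measurable_pullback (f : T ↪ S) :
    Measurable (pullback f : Colouring Z m S → Colouring Z m T) := by
  unfold pullback
  fun_prop

lemma measurable_extend :
    Measurable (extend : Colouring Z m S × (Set.powersetCard S m → Z m) → _) := by
  refine measurable_pi_iff.2 fun i => ?_
  induction i using Fin.lastCases with
  | last =>
    simp only [extend, Fin.snoc_last]
    exact measurable_snd (α := Colouring Z m S)
  | cast i =>
    simp only [extend, Fin.snoc_castSucc]
    exact (measurable_pi_apply i).comp measurable_fst

/-- A probability measure on the space of `K`-coloured hypergraphs on `S` (of rank `k`, for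
`m = k + 1`) that is invariant under all finitely supported permutations of `S`. -/
structure IsExchangeable (μ : Measure (Colouring Z m S)) : Prop where
  isProbabilityMeasure : IsProbabilityMeasure μ
  map_eq : ∀ g : Equiv.Perm S, {s | g s ≠ s}.Finite → μ.map (pullback g.toEmbedding) = μ

variable {X : Type w} [MeasurableSpace X] {i : ℕ}

/-- Symmetry of a kernel `Z_0 × Z_1^i × ⋯ × Z_{i-1}^(i choose (i-1)) ⇝ X` under the
coordinate-permuting action of `Sym([i])` on its domain. -/
def IsSymmetricKernel (Q : Kernel (Colouring Z i (Fin i)) X) : Prop :=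
  ∀ (g : Equiv.Perm (Fin i)) (z : Colouring Z i (Fin i)), Q (pullback g.toEmbedding z) = Q z

/-- For a symmetric kernel, `Q(z_∅, (z_s)_{s ∈ e}, …)` does not depend on the order in which the
elements of `e` are listed. -/
lemma IsSymmetricKernel.pullback_eq {S : Type v} {Q : Kernel (Colouring Z i (Fin i)) X}
    (hQ : IsSymmetricKernel Q) (z : Colouring Z i S) (e : Set.powersetCard S i) (f : Fin i ↪ S)
    (hf : Set.powersetCard.ofFinEmb i S f = e) : Q (pullback f z) = Q (pullback (enum e) z) := by
  have hr : Set.range f = Set.range (enum e) := by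
    rw [← Set.powersetCard.coe_ofFinEmb, ← Set.powersetCard.coe_ofFinEmb, hf, ofFinEmb_enum]
  let g : Equiv.Perm (Fin i) := (Equiv.ofInjective f f.injective).trans
    ((Equiv.setCongr hr).trans (Equiv.ofInjective (enum e) (enum e).injective).symm)
  have hg : ∀ j, enum e (g j) = f j := fun j =>
    Equiv.apply_ofInjective_symm (enum e).injective _
  rw [← hQ g (pullback (enum e) z)]
  congr 1
  funext j a
  unfold pullback
  congr 1
  apply Subtype.ext
  simp only [Set.powersetCard.val_map, Finset.map_map]
  congr 1
  ext j
  exact (hg j).symm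

/-- The kernel that colours every `i`-subset `e` of `S` independently, according to the law
`Q(z_∅, (z_s)_{s ∈ e}, …, (z_a)_{a ⊂ e, |a| = i - 1})`, given the colours `z` of all subsets of
`S` of size less than `i`. -/
noncomputable def independentKernel (S : Type v) (Q : Kernel (Colouring Z i (Fin i)) X)
    [IsMarkovKernel Q] : Kernel (Colouring Z i S) (Set.powersetCard S i → X) where
  toFun z := Measure.infinitePi fun e => Q (pullback (enum e) z)
  measurable' := by
    refine Measurable.measure_of_isPiSystem_of_isProbabilityMeasure
      generateFrom_squareCylinders.symm
      (isPiSystem_squareCylinders (fun _ => MeasurableSpace.isPiSystem_measurableSet)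
        fun _ => MeasurableSet.univ) ?_
    rintro _ ⟨s, t, ht, rfl⟩
    simp only [Set.mem_pi, Set.mem_univ, forall_const] at ht
    simp_rw [Measure.infinitePi_pi _ fun e _ => ht e]
    exact Finset.measurable_prod _ fun e _ =>
      (Q.measurable_coe (ht e)).comp (measurable_pullback _)

instance (S : Type v) (Q : Kernel (Colouring Z i (Fin i)) X) [IsMarkovKernel Q] :
    IsMarkovKernel (independentKernel S Q) :=
  ⟨fun z => inferInstanceAs
    (IsProbabilityMeasure (Measure.infinitePi fun e => Q (pullback (enum e) z)))⟩

end Basic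

/-- A sequence of ingredients `(Z_0, κ_0, μ_0), (Z_1, κ_1, P_1), …, (Z_{k-1}, κ_{k-1}, P_{k-1}),
(K_k, P_k)` for the palette `K_0, …, K_k`. The recipe uses only `Z 0, …, Z (k - 1)` and only the
kernels between these; the later entries are arbitrary (e.g. one-point spaces). -/
structure Ingredients (k : ℕ) (K : ℕ → Type u) [∀ i, MeasurableSpace (K i)] where
  Z : ℕ → Type u
  [measurableSpace : ∀ i, MeasurableSpace (Z i)]
  [standardBorelSpace : ∀ i, StandardBorelSpace (Z i)]
  /-- the law `μ_0` on `Z_0` -/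
  μ₀ : Measure (Z 0)
  [isProbabilityMeasure : IsProbabilityMeasure μ₀]
  /-- the maps `κ_i : Z_i → K_i`, `i < k` -/
  κ : (i : Fin k) → Z i → K i
  measurable_κ : ∀ i, Measurable (κ i)
  /-- `P i` is the kernel `P_{i+1} : Z_0 × Z_1^(i+1) × ⋯ × Z_i^((i+1) choose i) ⇝ Z_{i+1}` -/
  P : (i : ℕ) → Kernel (Colouring Z (i + 1) (Fin (i + 1))) (Z (i + 1))
  [isMarkovKernel : ∀ i, IsMarkovKernel (P i)]
  symmetric : ∀ i, IsSymmetricKernel (P i)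
  /-- the last kernel `P_k : Z_0 × Z_1^k × ⋯ × Z_{k-1}^(k choose (k-1)) ⇝ K_k` -/
  Plast : Kernel (Colouring Z k (Fin k)) (K k)
  [isMarkovKernel_last : IsMarkovKernel Plast]
  symmetric_last : IsSymmetricKernel Plast

namespace Ingredients

attribute [instance] measurableSpace standardBorelSpace isProbabilityMeasure isMarkovKernel
  isMarkovKernel_last

variable {k : ℕ} {K : ℕ → Type u} [∀ i, MeasurableSpace (K i)] (I : Ingredients k K)

/-- The kernels of all ranks, the law `μ_0` being a kernel from the one-point space. -/
noncomputable def kernel : (i : ℕ) → Kernel (Colouring I.Z i (Fin i)) (I.Z i)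
  | 0 => Kernel.const _ I.μ₀
  | i + 1 => I.P i

instance (i : ℕ) : IsMarkovKernel (I.kernel i) := by
  cases i with
  | zero => exact inferInstanceAs (IsMarkovKernel (Kernel.const _ I.μ₀))
  | succ i => exact inferInstanceAs (IsMarkovKernel (I.P i))

/-- The joint law, after the first `m` steps of the standard recipe, of the auxiliary colours
`z_a ∈ Z_{|a|}` of all subsets `a` of `S` of size less than `m`. -/
noncomputable def auxLaw (S : Type v) : (m : ℕ) → Measure (Colouring I.Z m S)
  | 0 => Measure.dirac fun i => i.elim0
  | m + 1 => (auxLaw S m ⊗ₘ independentKernel S (I.kernel m)).map extend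

/-- The colouring in `K^(S)` that is output by the recipe: `ω_a = κ_{|a|}(z_a)` for `|a| < k`, and
`ω_e` as chosen in the last step for `|e| = k`. -/
def output (S : Type v) (p : Colouring I.Z k S × (Set.powersetCard S k → K k)) :
    Colouring K (k + 1) S :=
  extend (fun i a => I.κ i (p.1 i a), p.2)

/-- The law on `K^(S)` that the ingredients yield upon following the standard recipe. -/
noncomputable def recipeLaw (S : Type v) : Measure (Colouring K (k + 1) S) :=
  (I.auxLaw S k ⊗ₘ independentKernel S I.Plast).map (I.output S)

instance (S : Type v) (m : ℕ) : IsProbabilityMeasure (I.auxLaw S m) := by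
  induction m with
  | zero => exact inferInstanceAs (IsProbabilityMeasure (Measure.dirac _))
  | succ m ih => exact Measure.isProbabilityMeasure_map measurable_extend.aemeasurable

lemma measurable_output (S : Type v) : Measurable (I.output S) := by
  have h := I.measurable_κ
  refine measurable_extend.comp (Measurable.prodMk ?_ measurable_snd)
  exact measurable_pi_iff.2 fun i => measurable_pi_iff.2 fun a =>
    (h i).comp (by fun_prop)

instance (S : Type v) : IsProbabilityMeasure (I.recipeLaw S) :=
  Measure.isProbabilityMeasure_map (I.measurable_output S).aemeasurable

end Ingredients

end ExchHypergraph

namespace ExchHypergraph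

universe u v w x

/-! ### From finitely supported permutations to injections. -/

section Exchangeability

variable {Z : ℕ → Type u} {m : ℕ} {T : Type v} {S : Type w} {V : Type x}

/-! Finitely many colours involve finitely many vertices, so exchangeability upgrades to invariance
under every injection of `S` into itself. Since `S ⊕ ℕ ≃ S`, the law `μ` is then the `S`-marginal of
a law on hypergraphs on `S ⊕ ℕ` with the same invariance. The extra vertices `ℕ` are a reservoir
that supplies the hidden randomness: the auxiliary colour `z_a` of `a ⊂ S` is the family of colours
of all `a ∪ t` with `t ⊂ ℕ` finite, and `κ_i` reads off the entry `t = ∅`.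

The heart is that, given the `z_a` with `a ⊊ u`, the colour `z_u` is independent of the colours of
all sets not containing `u`. For an event depending on finitely many entries of `z_u`, choose an
injection that fixes `u` and the finitely many naturals involved and sends every other vertex into
`ℕ` (`exists_embedding_fixing`). It preserves the event and pulls the large σ-algebra back into the
one generated by the `z_a`, `a ⊊ u`. An `L²` argument (`condExp_eq_of_comap_le`) shows that the two
σ-algebras give the same conditional probability.

By invariance, one symmetric kernel `Q` gives the conditional law of `z_u` for all `u` of a given
size `m` (`exists_symmetric_kernel`). If `v ≠ u` are `m`-sets, `z_v` involves only sets not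
containing `u`, so the `z_u` with `|u| = m` are conditionally independent given all smaller
auxiliary colours (`lintegral_mul_prod_indicator_linkColour`). This is exactly one step of the
recipe. -/

lemma pullback_pullback (f : T ↪ S) (g : S ↪ V) (ω : Colouring Z m V) :
    pullback f (pullback g ω) = pullback (f.trans g) ω := by
  funext i a
  simp only [pullback]
  congr 1
  apply Subtype.ext
  simp [Finset.map_map]

lemma pullback_congr {f g : T ↪ S} {ω : Colouring Z m S} {i : Fin m}
    {a : Set.powersetCard T (i : ℕ)} (h : ∀ x ∈ a.1, f x = g x) :
    pullback f ω i a = pullback g ω i a := by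
  simp only [pullback]
  congr 1
  apply Subtype.ext
  simp only [Set.powersetCard.val_map]
  ext y
  simp only [Finset.mem_map]
  exact exists_congr fun x => and_congr_right fun hx => by rw [h x hx]

/-- An injection agrees on each finite set with a finitely supported permutation. -/
lemma exists_perm_eqOn (f : S ↪ S) (F : Finset S) :
    ∃ g : Equiv.Perm S, {s | g s ≠ s}.Finite ∧ ∀ s ∈ F, g s = f s := by
  classical
  -- The restriction of `f` to `F` is an injection between subsets of the finite set `A`, so it
  -- extends to a permutation of `A`, and by the identity to all of `S`.
  let A : Finset S := F ∪ F.image f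
  obtain ⟨g, hg⟩ := Finset.exists_equiv_extend_of_card_eq (α := A) (t := A) (by simp)
    (s := Finset.univ.filter fun x : A => (x : S) ∈ F) (f := fun x => f x)
    (by
      intro y hy
      simp only [Finset.mem_image, Finset.mem_filter, Finset.mem_univ, true_and] at hy
      obtain ⟨x, hx, rfl⟩ := hy
      exact Finset.mem_union_right _ (Finset.mem_image_of_mem _ hx))
    (fun x _ y _ h => Subtype.ext (f.injective h))
  refine ⟨Equiv.Perm.ofSubtype (p := fun x => x ∈ A) g, A.finite_toSet.subset ?_, fun s hs => ?_⟩
  · intro s hs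
    by_contra h
    exact hs (Equiv.Perm.ofSubtype_apply_of_not_mem g h)
  · have hsA : s ∈ A := Finset.mem_union_left _ hs
    rw [Equiv.Perm.ofSubtype_apply_of_mem g hsA]
    exact hg ⟨s, hsA⟩ (by simpa using hs)

variable [∀ i, MeasurableSpace (Z i)]

/-- A finite measure on a space of coloured hypergraphs is determined by the laws of finite
collections of colours. -/
lemma Colouring.measure_ext {μ ν : Measure (Colouring Z m T)} [IsFiniteMeasure μ]
    (h : ∀ (s : Finset (Σ i : Fin m, Set.powersetCard T (i : ℕ))) (t : ∀ p : (Σ i : Fin m,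
      Set.powersetCard T (i : ℕ)), Set (Z p.1)), (∀ p, MeasurableSet (t p)) →
      μ {ω | ∀ p ∈ s, ω p.1 p.2 ∈ t p} = ν {ω | ∀ p ∈ s, ω p.1 p.2 ∈ t p}) : μ = ν := by
  let e := MeasurableEquiv.piCurry
    (fun (i : Fin m) (_ : Set.powersetCard T (i : ℕ)) => Z i)
  -- Uncurrying gives a single product over the sigma type, where the square cylinders form a
  -- generating π-system.
  have key : μ.map e.symm = ν.map e.symm := by
    refine ext_of_generate_finite _ generateFrom_squareCylinders.symm
      (isPiSystem_squareCylinders (fun _ => MeasurableSpace.isPiSystem_measurableSet)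
        fun _ => MeasurableSet.univ) ?_ ?_
    · rintro _ ⟨s, t, ht, rfl⟩
      simp only [Set.mem_pi, Set.mem_univ, forall_const] at ht
      rw [e.symm.map_apply, e.symm.map_apply]
      exact h s t ht
    · rw [e.symm.map_apply, e.symm.map_apply]
      simpa using h ∅ (fun _ => Set.univ) fun _ => MeasurableSet.univ
  have := congrArg (Measure.map e) key
  simpa using this

/-- Exchangeability implies invariance under all injections of the vertex set into itself. -/
lemma IsExchangeable.map_pullback {μ : Measure (Colouring Z m S)} (hμ : IsExchangeable μ)
    (f : S ↪ S) : μ.map (pullback f) = μ := by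
  classical
  have := hμ.isProbabilityMeasure
  have := Measure.isProbabilityMeasure_map (μ := μ)
    (measurable_pullback (Z := Z) (m := m) f).aemeasurable
  refine Colouring.measure_ext fun s t ht => ?_
  obtain ⟨g, hg, hgf⟩ := exists_perm_eqOn f (s.biUnion fun p => p.2.1)
  have hm : MeasurableSet {ω : Colouring Z m S | ∀ p ∈ s, ω p.1 p.2 ∈ t p} := by
    have : {ω : Colouring Z m S | ∀ p ∈ s, ω p.1 p.2 ∈ t p} =
        ⋂ p ∈ s, (fun ω : Colouring Z m S => ω p.1 p.2) ⁻¹' t p := by ext; simp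
    rw [this]
    exact Finset.measurableSet_biInter _ fun p _ => measurableSet_preimage (by fun_prop) (ht p)
  conv_rhs => rw [← hμ.map_eq g hg]
  rw [Measure.map_apply (measurable_pullback _) hm, Measure.map_apply (measurable_pullback _) hm]
  congr 1
  ext ω
  simp only [Set.mem_preimage, Set.mem_ofPred_eq]
  refine forall₂_congr fun p hp => ?_
  rw [pullback_congr (f := f) (g := g.toEmbedding) fun x hx =>
    (hgf x (Finset.mem_biUnion.2 ⟨p, hp, hx⟩)).symm]

end Exchangeability

/-! ### Conditional expectations and measure-preserving maps. -/

section CondExp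

variable {Ω : Type*} {m₁ m₂ m₀ : MeasurableSpace Ω} {μ : Measure Ω} [IsProbabilityMeasure μ]

/-- Conditional expectations commute with measure-preserving maps. -/
lemma condExp_comp_measurePreserving {Φ : Ω → Ω} (hΦ : MeasurePreserving Φ μ μ) (hm : m₁ ≤ m₀)
    {f : Ω → ℝ} (hf : Integrable f μ) :
    (μ[f | m₁]) ∘ Φ =ᵐ[μ] μ[f ∘ Φ | m₁.comap Φ] := by
  have hle : m₁.comap Φ ≤ m₀ := (MeasurableSpace.comap_mono hm).trans hΦ.measurable.comap_le
  have hint : Integrable ((μ[f | m₁]) ∘ Φ) μ :=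
    hΦ.integrable_comp_of_integrable integrable_condExp
  refine ae_eq_condExp_of_forall_setIntegral_eq hle (hΦ.integrable_comp_of_integrable hf)
    (fun s _ _ => hint.integrableOn) ?_ ?_
  · rintro _ ⟨B, hB, rfl⟩ -
    have h : ∀ g : Ω → ℝ, Integrable g μ → ∫ x in Φ ⁻¹' B, (g ∘ Φ) x ∂μ = ∫ x in B, g x ∂μ := by
      intro g hg
      have h1 : (μ.restrict (Φ ⁻¹' B)).map Φ = μ.restrict B := by
        rw [← Measure.restrict_map hΦ.measurable (hm _ hB), hΦ.map_eq]
      rw [← h1, integral_map hΦ.measurable.aemeasurable]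
      · rfl
      · rw [h1]; exact hg.aestronglyMeasurable.restrict
    rw [h _ integrable_condExp, h _ hf, setIntegral_condExp hm hf hB]
  · exact (stronglyMeasurable_condExp.comp_measurable
      (comap_measurable (m := m₁) Φ)).aestronglyMeasurable

/-- If a measure-preserving map `Φ` fixes a bounded function `f` and maps the `σ`-algebra `m₂`
into a sub-`σ`-algebra `m₁`, then conditioning `f` on `m₂` is the same as conditioning it on `m₁`:
the two conditional expectations have the same `L²`-norm. -/
lemma condExp_eq_of_comap_le {Φ : Ω → Ω} (hΦ : MeasurePreserving Φ μ μ) (h₁₂ : m₁ ≤ m₂)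
    (h₂ : m₂ ≤ m₀) (hcomap : m₂.comap Φ ≤ m₁) {f : Ω → ℝ} (hf : Integrable f μ)
    (hbdd : ∀ x, |f x| ≤ 1) (hfΦ : f ∘ Φ = f) : μ[f | m₂] =ᵐ[μ] μ[f | m₁] := by
  set h : Ω → ℝ := μ[f | m₂]
  have hb : ∀ᵐ x ∂μ, |h x| ≤ 1 := ae_bdd_abs_condExp_of_ae_bdd_abs (.of_forall hbdd)
  have hb' : ∀ᵐ x ∂μ, |h (Φ x)| ≤ 1 := hΦ.quasiMeasurePreserving.ae hb
  have hi : Integrable h μ := integrable_condExp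
  have hi' : Integrable (h ∘ Φ) μ := hΦ.integrable_comp_of_integrable hi
  have hsm : StronglyMeasurable[m₂.comap Φ] (h ∘ Φ) :=
    stronglyMeasurable_condExp.comp_measurable (comap_measurable (m := m₂) Φ)
  have hle : m₂.comap Φ ≤ m₀ := hcomap.trans (h₁₂.trans h₂)
  -- As `f ∘ Φ = f`, the function `h ∘ Φ` is the conditional expectation of `f` given `m₂.comap Φ`;
  -- by the tower property it is the projection of `h` to that smaller σ-algebra.
  have hcond : h ∘ Φ =ᵐ[μ] μ[h | m₂.comap Φ] := by
    refine (condExp_comp_measurePreserving hΦ h₂ hf).trans ?_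
    rw [hfΦ]
    exact (condExp_condExp_of_le (hcomap.trans h₁₂) h₂).symm
  have i1 : Integrable (fun x => h x * h x) μ :=
    hi.bdd_mul (c := 1) hi.aestronglyMeasurable (by simpa using hb)
  have i2 : Integrable (fun x => h (Φ x) * h x) μ :=
    hi.bdd_mul (c := 1) hi'.aestronglyMeasurable (by simpa using hb')
  have i3 : Integrable (fun x => h (Φ x) * h (Φ x)) μ :=
    hi'.bdd_mul (c := 1) hi'.aestronglyMeasurable (by simpa using hb')
  have e1 : ∫ x, h (Φ x) * h (Φ x) ∂μ = ∫ x, h x * h x ∂μ := by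
    have : AEStronglyMeasurable (fun x => h x * h x) (μ.map Φ) := by
      rw [hΦ.map_eq]; exact i1.aestronglyMeasurable
    rw [← integral_map (f := fun x => h x * h x) hΦ.measurable.aemeasurable this, hΦ.map_eq]
  have e2 : ∫ x, h (Φ x) * h x ∂μ = ∫ x, h (Φ x) * h (Φ x) ∂μ := by
    rw [← integral_condExp hle]
    refine integral_congr_ae ?_
    have := condExp_mul_of_stronglyMeasurable_left (μ := μ) hsm (g := h) i2 hi
    filter_upwards [this, hcond] with x hx hx'
    refine hx.trans ?_
    simp only [Pi.mul_apply, ← hx', Function.comp_apply]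
  have i12 : Integrable (fun x => h x * h x - 2 * (h (Φ x) * h x)) μ := i1.sub (i2.const_mul 2)
  have hsq : (fun x => (h x - h (Φ x)) * (h x - h (Φ x))) =
      fun x => h x * h x - 2 * (h (Φ x) * h x) + h (Φ x) * h (Φ x) := by
    funext x; ring
  -- Pythagoras: a projection of `h` with the same `L²`-norm as `h` must be `h`.
  have e3 : ∫ x, (h x - h (Φ x)) * (h x - h (Φ x)) ∂μ = 0 := by
    rw [hsq, integral_add i12 i3, integral_sub i1 (i2.const_mul 2), integral_const_mul, e2, e1]
    ring
  have heq : h =ᵐ[μ] h ∘ Φ := by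
    rw [integral_eq_zero_iff_of_nonneg (fun x => mul_self_nonneg _)
      (by rw [hsq]; exact i12.add i3)] at e3
    filter_upwards [e3] with x hx
    exact sub_eq_zero.1 (mul_self_eq_zero.1 hx)
  -- Now `h` agrees a.e. with an `m₁`-measurable function, so conditioning on `m₁` does not change
  -- it.
  calc h =ᵐ[μ] h ∘ Φ := heq
    _ = μ[h ∘ Φ | m₁] := (condExp_of_stronglyMeasurable (h₁₂.trans h₂)
        (hsm.mono hcomap) hi').symm
    _ =ᵐ[μ] μ[h | m₁] := condExp_congr_ae heq.symm
    _ =ᵐ[μ] μ[f | m₁] := condExp_condExp_of_le h₁₂ h₂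

end CondExp

/-! ### Auxiliary colours and their dependence on the boundary. -/

/-- The auxiliary palette: a colour of an `i`-subset `a` of `S` in `AuxPalette k K i` records the
`K`-colours of all the sets `a ∪ t`, where `t` is a finite set of additional vertices. -/
abbrev AuxPalette (k : ℕ) (K : ℕ → Type u) (i : ℕ) : Type u :=
  (t : {t : Finset ℕ // i + t.card ≤ k}) → K (i + t.1.card)

section Aux

variable {k : ℕ} {K : ℕ → Type u} {S : Type v} {T : Type w} {i m : ℕ}

/-- The colours, in a hypergraph on `S ⊕ ℕ`, of the sets whose trace on `S` is `a`. -/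
def linkColour (a : Set.powersetCard S i) (ω : Colouring K (k + 1) (S ⊕ ℕ)) : AuxPalette k K i :=
  fun t => ω ⟨i + t.1.card, Nat.lt_succ_of_le t.2⟩ ⟨a.1.disjSum t.1, by simp⟩

/-- The auxiliary colours of all subsets of `S` of size less than `m`. -/
def auxColouring (m : ℕ) (ω : Colouring K (k + 1) (S ⊕ ℕ)) : Colouring (AuxPalette k K) m S :=
  fun _ a => linkColour a ω

/-- The auxiliary colours of the proper subsets of `f([m])`, indexed by proper subsets of `[m]`. -/
def boundaryColouring (f : Fin m ↪ S) (ω : Colouring K (k + 1) (S ⊕ ℕ)) :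
    Colouring (AuxPalette k K) m (Fin m) :=
  pullback f (auxColouring m ω)

lemma linkColour_pullback (f : T ↪ S) (a : Set.powersetCard T i)
    (ω : Colouring K (k + 1) (S ⊕ ℕ)) :
    linkColour a (pullback (f.sumMap (Function.Embedding.refl ℕ)) ω) =
      linkColour (Set.powersetCard.map i f a) ω := by
  funext t
  simp only [linkColour, pullback]
  congr 1
  apply Subtype.ext
  simp only [Set.powersetCard.val_map]
  ext (x | x) <;> simp

lemma linkColour_pullback_of_fixed {φ : S ⊕ ℕ ↪ S ⊕ ℕ} {a : Set.powersetCard S i}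
    {t : {t : Finset ℕ // i + t.card ≤ k}} (ha : ∀ s ∈ a.1, φ (.inl s) = .inl s)
    (ht : ∀ n ∈ t.1, φ (.inr n) = .inr n) (ω : Colouring K (k + 1) (S ⊕ ℕ)) :
    linkColour a (pullback φ ω) t = linkColour a ω t := by
  simp only [linkColour]
  rw [pullback_congr (g := Function.Embedding.refl _)]
  · simp only [pullback]
    congr 1
    apply Subtype.ext
    simp
  · rintro (s | n) h
    · exact ha s (by simpa using h)
    · exact ht n (by simpa using h)

/-- There is an injection of `S ⊕ ℕ` into `u ∪ ℕ` that fixes `u` and the first `N` naturals. -/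
lemma exists_embedding_fixing [Countable S] (u : Finset S) (N : ℕ) :
    ∃ φ : S ⊕ ℕ ↪ S ⊕ ℕ, (∀ s ∈ u, φ (.inl s) = .inl s) ∧ (∀ n < N, φ (.inr n) = .inr n) ∧
      ∀ y s, φ y = .inl s → s ∈ u := by
  classical
  obtain ⟨c, hc⟩ := exists_injective_nat S
  -- Vertices outside `u` go to even offsets from `N` and naturals from `N` on to odd offsets, so
  -- the images do not collide.
  let φ : S ⊕ ℕ → S ⊕ ℕ := Sum.elim
    (fun s => if s ∈ u then .inl s else .inr (N + 2 * c s))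
    (fun n => if n < N then .inr n else .inr (N + 2 * n + 1))
  have hφ : Function.Injective φ := by
    rintro (s | n) (s' | n') h
    · simp only [φ, Sum.elim_inl] at h
      split_ifs at h with h1 h2
      · simpa using h
      · simp only [Sum.inr.injEq] at h
        rw [hc (show c s = c s' by omega)]
    · simp only [φ, Sum.elim_inl, Sum.elim_inr] at h
      split_ifs at h <;> simp only [Sum.inr.injEq] at h <;> omega
    · simp only [φ, Sum.elim_inl, Sum.elim_inr] at h
      split_ifs at h <;> simp only [Sum.inr.injEq] at h <;> omega
    · simp only [φ, Sum.elim_inr] at h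
      split_ifs at h <;> simp only [Sum.inr.injEq] at h <;> congr 1 <;> omega
  refine ⟨⟨φ, hφ⟩, fun s hs => by simp [φ, hs], fun n hn => by simp [φ, hn], ?_⟩
  rintro (s | n) s' h
  · simp only [φ, Function.Embedding.coeFn_mk, Sum.elim_inl] at h
    split_ifs at h with h1
    · simp only [Sum.inl.injEq] at h
      exact h ▸ h1
  · simp only [φ, Function.Embedding.coeFn_mk, Sum.elim_inr] at h
    split_ifs at h

variable [∀ i, MeasurableSpace (K i)]

lemma measurable_linkColour (a : Set.powersetCard S i) :
    Measurable (linkColour a : Colouring K (k + 1) (S ⊕ ℕ) → AuxPalette k K i) := by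
  unfold linkColour
  fun_prop

lemma measurable_auxColouring (m : ℕ) :
    Measurable (auxColouring m : Colouring K (k + 1) (S ⊕ ℕ) → Colouring (AuxPalette k K) m S) :=
  measurable_pi_iff.2 fun _ => measurable_pi_iff.2 fun _ => measurable_linkColour _

lemma measurable_boundaryColouring (f : Fin m ↪ S) :
    Measurable (boundaryColouring f : Colouring K (k + 1) (S ⊕ ℕ) → _) :=
  (measurable_pullback f).comp (measurable_auxColouring m)

variable (k K) in
/-- The `σ`-algebra generated by the colours of all sets of vertices that do not contain `u`. -/
@[reducible] def avoidingSigma (u : Finset S) : MeasurableSpace (Colouring K (k + 1) (S ⊕ ℕ)) :=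
  ⨆ (i : Fin (k + 1)) (e : Set.powersetCard (S ⊕ ℕ) (i : ℕ)) (_ : ¬ u ⊆ e.1.toLeft),
    MeasurableSpace.comap (fun ω : Colouring K (k + 1) (S ⊕ ℕ) => ω i e) inferInstance

lemma avoidingSigma_le (u : Finset S) : avoidingSigma k K u ≤ MeasurableSpace.pi :=
  iSup_le fun i => iSup_le fun e => iSup_le fun _ =>
    Measurable.comap_le (f := fun ω : Colouring K (k + 1) (S ⊕ ℕ) => ω i e) (by fun_prop)

/-- Every set entering the link colour of `a` has trace `a` on `S`, so none of them contains `u`. -/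
lemma measurable_linkColour_avoidingSigma {u : Finset S} {a : Set.powersetCard S i}
    (h : ¬ u ⊆ a.1) : Measurable[avoidingSigma k K u] (linkColour a :
      Colouring K (k + 1) (S ⊕ ℕ) → AuxPalette k K i) := by
  refine @measurable_pi_lambda _ _ _ (avoidingSigma k K u) _ _ fun t => ?_
  refine Measurable.of_comap_le ?_
  exact le_iSup_of_le ⟨i + t.1.card, Nat.lt_succ_of_le t.2⟩
    (le_iSup_of_le ⟨a.1.disjSum t.1, by simp⟩ (le_iSup_of_le (by simpa using h) le_rfl))

lemma measurable_auxColouring_avoidingSigma (u : Set.powersetCard S m) :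
    Measurable[avoidingSigma k K u.1] (auxColouring m : Colouring K (k + 1) (S ⊕ ℕ) → _) := by
  refine @measurable_pi_lambda _ _ _ (avoidingSigma k K u.1) _ _ fun i => ?_
  refine @measurable_pi_lambda _ _ _ (avoidingSigma k K u.1) _ _ fun a => ?_
  refine measurable_linkColour_avoidingSigma fun h => ?_
  have := Finset.card_le_card h
  rw [Set.powersetCard.card_eq, Set.powersetCard.card_eq] at this
  omega

/-- A single colour is a function of the link colour of its trace on `S`. -/
lemma measurable_apply_of_linkColour {𝓜 : MeasurableSpace (Colouring K (k + 1) (S ⊕ ℕ))}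
    {n : Fin (k + 1)} {e : Set.powersetCard (S ⊕ ℕ) (n : ℕ)} {a : Set.powersetCard S i}
    {t : Finset ℕ} (he : e.1 = a.1.disjSum t)
    (ha : Measurable[𝓜] (linkColour a : _ → AuxPalette k K i)) :
    Measurable[𝓜] fun ω : Colouring K (k + 1) (S ⊕ ℕ) => ω n e := by
  obtain ⟨n, hn⟩ := n
  have hcard : n = i + t.card := by
    have h := e.2
    rw [Set.powersetCard.mem_iff, he] at h
    simpa using h.symm
  subst hcard
  obtain ⟨e, h⟩ := e
  subst he
  exact (measurable_pi_apply (⟨t, Nat.le_of_lt_succ hn⟩ : {t : Finset ℕ // i + t.card ≤ k})).comp ha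

/-- The trace of `φ(e)` on `S` lies in `u` because `φ` reaches no other vertex of `S`. It is a
proper subset of `u` when `e` does not contain `u`, because `φ` is injective and fixes `u`. The
colour of `φ(e)` is thus one entry of the auxiliary colour of a proper subset of `u`. -/
lemma comap_pullback_avoidingSigma_le (u : Set.powersetCard S m) {φ : S ⊕ ℕ ↪ S ⊕ ℕ}
    (hφ : ∀ s ∈ u.1, φ (.inl s) = .inl s) (hφ' : ∀ y s, φ y = .inl s → s ∈ u.1) :
    (avoidingSigma k K u.1).comap (pullback φ) ≤
      MeasurableSpace.comap (boundaryColouring (enum u)) inferInstance := by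
  classical
  simp only [avoidingSigma, MeasurableSpace.comap_iSup, MeasurableSpace.comap_comp]
  refine iSup_le fun n => iSup_le fun e => iSup_le fun he => ?_
  have hu : u.1 = Finset.univ.map (enum u) := by
    conv_lhs => rw [← ofFinEmb_enum u]
    simp
  have hsub : (e.1.map φ).toLeft ⊆ u.1 := by
    intro s hs
    simp only [Finset.mem_toLeft, Finset.mem_map] at hs
    obtain ⟨y, -, hy⟩ := hs
    exact hφ' y s hy
  have hne : ¬ u.1 ⊆ (e.1.map φ).toLeft := by
    intro h
    refine he fun s hs => ?_
    have := h hs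
    simp only [Finset.mem_toLeft, Finset.mem_map] at this ⊢
    obtain ⟨y, hy, hys⟩ := this
    rwa [← φ.injective (hys.trans (hφ s hs).symm)]
  obtain ⟨a, -, ha⟩ := Finset.subset_map_iff.1 (hu ▸ hsub)
  have hcard : a.card < m := by
    have := Finset.card_lt_card (Finset.ssubset_iff_subset_ne.2 ⟨hsub, fun h => hne h.ge⟩)
    rwa [ha, Finset.card_map, Set.powersetCard.card_eq] at this
  refine Measurable.comap_le ?_
  refine measurable_apply_of_linkColour (n := n) (e := Set.powersetCard.map (n : ℕ) φ e)
    (a := Set.powersetCard.map a.card (enum u) ⟨a, by simp⟩) (t := (e.1.map φ).toRight) ?_ ?_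
  · simp only [Set.powersetCard.val_map]
    rw [← ha, Finset.toLeft_disjSum_toRight]
  · have := (measurable_pi_apply (⟨a, by simp⟩ : Set.powersetCard (Fin m) a.card)).comp
      ((measurable_pi_apply (⟨a.card, hcard⟩ : Fin m)).comp
        (comap_measurable (boundaryColouring (k := k) (K := K) (enum u))))
    exact this

variable {μ : Measure (Colouring K (k + 1) (S ⊕ ℕ))} [IsProbabilityMeasure μ]

/-- For an exchangeable hypergraph on `S ⊕ ℕ`, the auxiliary colour of `u` interacts with all the
colours of sets not containing `u` only through the auxiliary colours of the proper subsets
of `u`. -/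
lemma condExp_linkColour_cylinder [Countable S]
    (hμ : ∀ φ : S ⊕ ℕ ↪ S ⊕ ℕ, μ.map (pullback φ) = μ) (u : Set.powersetCard S m)
    {C : Set (AuxPalette k K m)} (hC : C ∈ squareCylinders fun
      t : {t : Finset ℕ // m + t.card ≤ k} => {s : Set (K (m + t.1.card)) | MeasurableSet s})
    (hCm : MeasurableSet C) :
    μ[(linkColour u ⁻¹' C).indicator (fun _ => (1 : ℝ)) | avoidingSigma k K u.1] =ᵐ[μ]
      μ[(linkColour u ⁻¹' C).indicator (fun _ => (1 : ℝ)) |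
        MeasurableSpace.comap (boundaryColouring (enum u)) inferInstance] := by
  classical
  obtain ⟨F, A, -, rfl⟩ := hC
  -- The bound exceeds every natural occurring in the finitely many `t ∈ F`, so `φ` fixes all the
  -- sets `u ∪ t` on which the cylinder depends.
  obtain ⟨φ, h1, h2, h3⟩ := exists_embedding_fixing u.1 (F.sup fun t => t.1.sup id + 1)
  have hmeas : Measurable[avoidingSigma k K u.1]
      (boundaryColouring (k := k) (K := K) (enum u)) :=
    (measurable_pullback (enum u)).comp (measurable_auxColouring_avoidingSigma u)
  have hfix : ∀ ω : Colouring K (k + 1) (S ⊕ ℕ),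
      pullback φ ω ∈ linkColour u ⁻¹' (F : Set _).pi A ↔ ω ∈ linkColour u ⁻¹' (F : Set _).pi A := by
    intro ω
    simp only [Set.mem_preimage, Set.mem_pi, Finset.mem_coe]
    refine forall₂_congr fun t ht => ?_
    rw [linkColour_pullback_of_fixed h1]
    intro n hn
    refine h2 n ?_
    have hle := Finset.le_sup (f := fun t : {t : Finset ℕ // m + t.card ≤ k} => t.1.sup id + 1) ht
    have hle' := Finset.le_sup (f := id) hn
    simp only [id] at hle hle'
    omega
  have hmeas' : MeasurableSet (linkColour (k := k) (K := K) u ⁻¹' (F : Set _).pi A) :=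
    measurable_linkColour u hCm
  generalize linkColour (k := k) (K := K) u ⁻¹' (F : Set _).pi A = D at hfix hmeas'
  refine condExp_eq_of_comap_le (Φ := pullback φ) ⟨measurable_pullback φ, hμ φ⟩ hmeas.comap_le
    (avoidingSigma_le _) (comap_pullback_avoidingSigma_le u h1 h3)
    ((integrable_const 1).indicator hmeas') ?_ ?_
  · intro ω
    by_cases h : ω ∈ D <;> simp [h]
  · funext ω
    by_cases h : ω ∈ D
    · simp [h, (hfix ω).2 h]
    · simp [h, mt (hfix ω).1 h]

end Aux

/-! ### Symmetric disintegration. -/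

section Kernel

variable {Z : ℕ → Type u} [∀ i, MeasurableSpace (Z i)] {X : Type v} [MeasurableSpace X] {i : ℕ}

/-- The average of a kernel over the action of `Sym([i])` on its domain. -/
noncomputable def symmetrize (Q : Kernel (Colouring Z i (Fin i)) X) :
    Kernel (Colouring Z i (Fin i)) X where
  toFun z := (Fintype.card (Equiv.Perm (Fin i)) : ENNReal)⁻¹ •
    ∑ g : Equiv.Perm (Fin i), Q (pullback g.toEmbedding z)
  measurable' := by
    refine Measure.measurable_of_measurable_coe _ fun s hs => ?_
    simp only [Measure.smul_apply, Measure.finsetSum_apply, smul_eq_mul]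
    exact (Finset.measurable_sum _ fun g _ =>
      (Q.measurable_coe hs).comp (measurable_pullback _)).const_mul _

lemma symmetrize_apply (Q : Kernel (Colouring Z i (Fin i)) X) (z : Colouring Z i (Fin i))
    (s : Set X) : symmetrize Q z s = (Fintype.card (Equiv.Perm (Fin i)) : ENNReal)⁻¹ *
      ∑ g : Equiv.Perm (Fin i), Q (pullback g.toEmbedding z) s := by
  simp [symmetrize]

lemma inv_card_perm_mul_sum_const (c : ENNReal) :
    (Fintype.card (Equiv.Perm (Fin i)) : ENNReal)⁻¹ * ∑ _g : Equiv.Perm (Fin i), c = c := by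
  rw [Finset.sum_const, Finset.card_univ, nsmul_eq_mul, ← mul_assoc, ENNReal.inv_mul_cancel
    (by exact_mod_cast Fintype.card_ne_zero) (ENNReal.natCast_ne_top _), one_mul]

instance (Q : Kernel (Colouring Z i (Fin i)) X) [IsMarkovKernel Q] :
    IsMarkovKernel (symmetrize Q) :=
  ⟨fun z => ⟨by simp only [symmetrize_apply, measure_univ, inv_card_perm_mul_sum_const]⟩⟩

lemma isSymmetricKernel_symmetrize (Q : Kernel (Colouring Z i (Fin i)) X) :
    IsSymmetricKernel (symmetrize Q) := by
  intro h z
  ext s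
  rw [symmetrize_apply, symmetrize_apply]
  congr 1
  refine Fintype.sum_equiv (Equiv.mulLeft h) _ _ fun g => ?_
  rw [pullback_pullback]
  rfl

/-- A law on `Z_0 × Z_1^i × ⋯ × Z_{i-1}^(i choose (i-1)) × X` that is invariant under `Sym([i])`
disintegrates over its first marginal by means of a symmetric kernel. -/
lemma compProd_symmetrize_condKernel [StandardBorelSpace X] [Nonempty X]
    {ν : Measure (Colouring Z i (Fin i) × X)} [IsProbabilityMeasure ν]
    (hν : ∀ g : Equiv.Perm (Fin i), ν.map (Prod.map (pullback g.toEmbedding) id) = ν) :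
    ν.fst ⊗ₘ symmetrize ν.condKernel = ν := by
  refine Measure.ext_prod fun {s t} hs ht => ?_
  have hQ : ∀ g : Equiv.Perm (Fin i),
      Measurable fun z => ν.condKernel (pullback g.toEmbedding z) t := fun g =>
    (ν.condKernel.measurable_coe ht).comp (measurable_pullback (Z := Z) (m := i) g.toEmbedding)
  -- Each permuted conditional kernel again disintegrates `ν`, hence so does their average.
  have key : ∀ g : Equiv.Perm (Fin i),
      ∫⁻ z in s, ν.condKernel (pullback g.toEmbedding z) t ∂ν.fst = ν (s ×ˢ t) := by
    intro g
    have hm := measurable_pullback (Z := Z) (m := i) g.toEmbedding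
    -- The image of `s` under `pullback g`, written as a preimage under the inverse.
    let s' : Set (Colouring Z i (Fin i)) := pullback g.symm.toEmbedding ⁻¹' s
    have hs' : MeasurableSet s' := measurable_pullback _ hs
    have hss : pullback g.toEmbedding ⁻¹' s' = s := by
      ext z
      simp only [s', Set.mem_preimage, pullback_pullback]
      have : g.symm.toEmbedding.trans g.toEmbedding = Function.Embedding.refl _ := by
        ext x; simp
      rw [this]
      have : pullback (Function.Embedding.refl (Fin i)) z = z := by
        funext j a
        simp only [pullback]
        congr 1
        apply Subtype.ext
        simp
      rw [this]
    have hfst : ν.fst.map (pullback g.toEmbedding) = ν.fst := by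
      conv_rhs => rw [← hν g]
      rw [Measure.fst, Measure.fst, Measure.map_map hm measurable_fst,
        Measure.map_map measurable_fst (hm.prodMap measurable_id)]
      rfl
    calc ∫⁻ z in s, ν.condKernel (pullback g.toEmbedding z) t ∂ν.fst
        = ∫⁻ z in s', ν.condKernel z t ∂(ν.fst.map (pullback g.toEmbedding)) := by
          rw [setLIntegral_map hs' (ν.condKernel.measurable_coe ht) hm, hss]
      _ = (ν.fst ⊗ₘ ν.condKernel) (s' ×ˢ t) := by
          rw [hfst, Measure.compProd_apply_prod hs' ht]
      _ = ν.map (Prod.map (pullback g.toEmbedding) id) (s' ×ˢ t) := by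
          rw [hν g, Measure.disintegrate]
      _ = ν (s ×ˢ t) := by
          rw [Measure.map_apply (hm.prodMap measurable_id) (hs'.prod ht)]
          change ν ((pullback g.toEmbedding ⁻¹' s') ×ˢ t) = ν (s ×ˢ t)
          rw [hss]
  rw [Measure.compProd_apply_prod hs ht]
  simp only [symmetrize_apply]
  rw [lintegral_const_mul _ (Finset.measurable_sum _ fun g _ => hQ g),
    lintegral_finsetSum _ fun g _ => hQ g]
  simp only [key, inv_card_perm_mul_sum_const]

end Kernel

/-! ### One symmetric kernel for all sets of a given size. -/

section Aux

variable {k : ℕ} {K : ℕ → Type u} {S : Type v} {m : ℕ}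

/-- The auxiliary colour of `f([m])` together with those of its proper subsets. -/
def simplexColouring (f : Fin m ↪ S) (ω : Colouring K (k + 1) (S ⊕ ℕ)) :
    Colouring (AuxPalette k K) m (Fin m) × AuxPalette k K m :=
  (boundaryColouring f ω, linkColour (Set.powersetCard.ofFinEmb m S f) ω)

lemma simplexColouring_pullback (g : S ↪ S) (f : Fin m ↪ S) (ω : Colouring K (k + 1) (S ⊕ ℕ)) :
    simplexColouring f (pullback (g.sumMap (Function.Embedding.refl ℕ)) ω) =
      simplexColouring (f.trans g) ω := by
  have h : ∀ (i : ℕ) (a : Set.powersetCard (Fin m) i),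
      linkColour (Set.powersetCard.map i f a)
        (pullback (g.sumMap (Function.Embedding.refl ℕ)) ω) =
      linkColour (Set.powersetCard.map i (f.trans g) a) ω := by
    intro i a
    rw [linkColour_pullback]
    congr 1
    apply Subtype.ext
    simp [Finset.map_map]
  refine Prod.ext ?_ (h m _)
  funext i a
  exact h i a

lemma simplexColouring_perm (g : Equiv.Perm (Fin m)) (f : Fin m ↪ S)
    (ω : Colouring K (k + 1) (S ⊕ ℕ)) : simplexColouring (g.toEmbedding.trans f) ω =
      Prod.map (pullback g.toEmbedding) id (simplexColouring f ω) := by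
  refine Prod.ext ?_ ?_
  · exact (pullback_pullback g.toEmbedding f (auxColouring m ω)).symm
  · simp only [simplexColouring, Prod.map_snd, id]
    congr 1
    apply Subtype.ext
    simp [← Finset.map_map]

variable [∀ i, MeasurableSpace (K i)] {μ : Measure (Colouring K (k + 1) (S ⊕ ℕ))}

lemma measurable_simplexColouring (f : Fin m ↪ S) :
    Measurable (simplexColouring f : Colouring K (k + 1) (S ⊕ ℕ) → _) :=
  (measurable_boundaryColouring f).prodMk (measurable_linkColour _)

/-- Some permutation of `S` carries `f` to `f'`, and its extension by the identity on `ℕ` preserves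
`μ`. -/
lemma map_simplexColouring_eq (hμ : ∀ φ : S ⊕ ℕ ↪ S ⊕ ℕ, μ.map (pullback φ) = μ)
    (f f' : Fin m ↪ S) : μ.map (simplexColouring f) = μ.map (simplexColouring f') := by
  obtain ⟨g, hg⟩ := (MulAction.isMultiplyPretransitive_iff.1
    (Equiv.Perm.isMultiplyPretransitive S m)) f f'
  have hf : f.trans g.toEmbedding = f' := by
    rw [← hg]; rfl
  conv_lhs => rw [← hμ (g.toEmbedding.sumMap (Function.Embedding.refl ℕ))]
  rw [Measure.map_map (measurable_simplexColouring f) (measurable_pullback _)]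
  congr 1
  funext ω
  rw [Function.comp_apply, simplexColouring_pullback, hf]

/-- The conditional law of the auxiliary colour of an `m`-set given those of its proper subsets. -/
lemma exists_symmetric_kernel [∀ i, StandardBorelSpace (K i)] [Infinite S] [IsProbabilityMeasure μ]
    (hμ : ∀ φ : S ⊕ ℕ ↪ S ⊕ ℕ, μ.map (pullback φ) = μ) (m : ℕ) :
    ∃ Q : Kernel (Colouring (AuxPalette k K) m (Fin m)) (AuxPalette k K m),
      IsMarkovKernel Q ∧ IsSymmetricKernel Q ∧ ∀ f : Fin m ↪ S,
        μ.map (simplexColouring f) = μ.map (boundaryColouring f) ⊗ₘ Q := by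
  obtain ⟨f₀⟩ : Nonempty (Fin m ↪ S) := ⟨Fin.valEmbedding.trans (Infinite.natEmbedding S)⟩
  have : Nonempty (AuxPalette k K m) := by
    obtain ⟨ω⟩ := nonempty_of_isProbabilityMeasure μ
    exact ⟨linkColour (Set.powersetCard.ofFinEmb m S f₀) ω⟩
  -- Reordering the vertices of the simplex permutes its boundary colours but leaves the auxiliary
  -- colour of the full vertex set unchanged.
  have hinv : ∀ g : Equiv.Perm (Fin m), (μ.map (simplexColouring f₀)).map
      (Prod.map (pullback g.toEmbedding) id) = μ.map (simplexColouring f₀) := by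
    intro g
    have hg : Measurable (Prod.map (pullback (Z := AuxPalette k K) (m := m) g.toEmbedding)
        (id : AuxPalette k K m → AuxPalette k K m)) :=
      (measurable_pullback (Z := AuxPalette k K) g.toEmbedding).prodMap measurable_id
    rw [Measure.map_map hg (measurable_simplexColouring f₀),
      map_simplexColouring_eq hμ f₀ (g.toEmbedding.trans f₀)]
    congr 1
    funext ω
    exact (simplexColouring_perm g f₀ ω).symm
  have hfst : ∀ f : Fin m ↪ S, μ.map (boundaryColouring f) = (μ.map (simplexColouring f₀)).fst := by
    intro f
    rw [map_simplexColouring_eq hμ f₀ f, Measure.fst,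
      Measure.map_map measurable_fst (measurable_simplexColouring f)]
    rfl
  have hprob := Measure.isProbabilityMeasure_map (μ := μ)
    (measurable_simplexColouring (K := K) (k := k) f₀).aemeasurable
  simp only [hfst, fun f => map_simplexColouring_eq hμ f f₀]
  generalize μ.map (simplexColouring f₀) = ν at hinv hprob
  exact ⟨symmetrize ν.condKernel, inferInstance, isSymmetricKernel_symmetrize _,
    fun _ => (compProd_symmetrize_condKernel hinv).symm⟩

end Aux

/-! ### Conditional independence of the auxiliary colours of `m`-sets. -/

section Aux

variable {k : ℕ} {K : ℕ → Type u} {S : Type v} {m : ℕ} [∀ i, MeasurableSpace (K i)]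
  {Q : Kernel (Colouring (AuxPalette k K) m (Fin m)) (AuxPalette k K m)}

lemma measurable_kernel_boundaryColouring (f : Fin m ↪ S) {C : Set (AuxPalette k K m)}
    (hC : MeasurableSet C) : Measurable fun ω : Colouring K (k + 1) (S ⊕ ℕ) =>
      Q (boundaryColouring f ω) C :=
  (Q.measurable_coe hC).comp (measurable_boundaryColouring f)

variable [IsMarkovKernel Q] {μ : Measure (Colouring K (k + 1) (S ⊕ ℕ))} [IsProbabilityMeasure μ]

/-- Disintegrations are a.e. unique, so `Q` is a version of the regular conditional distribution. -/
lemma condExp_linkColour_eq_kernel [∀ i, StandardBorelSpace (K i)]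
    (u : Set.powersetCard S m) (hQ : μ.map (simplexColouring (enum u)) =
      μ.map (boundaryColouring (enum u)) ⊗ₘ Q) {C : Set (AuxPalette k K m)}
    (hC : MeasurableSet C) :
    μ[(linkColour u ⁻¹' C).indicator (fun _ => (1 : ℝ)) |
      MeasurableSpace.comap (boundaryColouring (enum u)) inferInstance] =ᵐ[μ]
      fun ω => (Q (boundaryColouring (enum u) ω) C).toReal := by
  have : Nonempty (AuxPalette k K m) := by
    obtain ⟨ω⟩ := nonempty_of_isProbabilityMeasure μ
    exact ⟨linkColour u ω⟩
  have hsimplex : simplexColouring (k := k) (K := K) (enum u) =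
      fun ω => (boundaryColouring (enum u) ω, linkColour u ω) := by
    funext ω
    simp only [simplexColouring, ofFinEmb_enum]
  rw [hsimplex] at hQ
  have h1 := condDistrib_ae_eq_of_measure_eq_compProd (boundaryColouring (enum u))
    (measurable_linkColour u).aemeasurable hQ
  have h2 := condDistrib_ae_eq_condExp (μ := μ) (measurable_boundaryColouring (enum u))
    (measurable_linkColour (K := K) (k := k) u) hC
  have h3 := ae_of_ae_map (measurable_boundaryColouring (enum u)).aemeasurable h1
  refine h2.symm.trans ?_
  filter_upwards [h3] with ω hω
  rw [hω]
  rfl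

/-- Given the colours of all sets not containing `u`, the auxiliary colour of `u` has law
`Q(z_∅, …)`. -/
lemma measure_inter_linkColour [Countable S] [∀ i, StandardBorelSpace (K i)]
    (hμ : ∀ φ : S ⊕ ℕ ↪ S ⊕ ℕ, μ.map (pullback φ) = μ) (u : Set.powersetCard S m)
    (hQ : μ.map (simplexColouring (enum u)) = μ.map (boundaryColouring (enum u)) ⊗ₘ Q)
    {D : Set (Colouring K (k + 1) (S ⊕ ℕ))} (hD : MeasurableSet[avoidingSigma k K u.1] D)
    {C : Set (AuxPalette k K m)} (hC : MeasurableSet C) :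
    μ (linkColour u ⁻¹' C ∩ D) = ∫⁻ ω in D, Q (boundaryColouring (enum u) ω) C ∂μ := by
  have hQm : Measurable fun ω : Colouring K (k + 1) (S ⊕ ℕ) => Q (boundaryColouring (enum u) ω) :=
    Q.measurable.comp (measurable_boundaryColouring _)
  have hmap : ∀ {C : Set (AuxPalette k K m)}, MeasurableSet C →
      (μ.restrict D).map (linkColour u) C = μ (linkColour u ⁻¹' C ∩ D) := fun hC => by
    rw [Measure.map_apply (measurable_linkColour u) hC,
      Measure.restrict_apply (measurable_linkColour u hC)]
  have hbind : ∀ {C : Set (AuxPalette k K m)}, MeasurableSet C →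
      (μ.restrict D).bind (fun ω => Q (boundaryColouring (enum u) ω)) C =
        ∫⁻ ω in D, Q (boundaryColouring (enum u) ω) C ∂μ := fun hC =>
    Measure.bind_apply hC hQm.aemeasurable
  -- For fixed `D` both sides are finite measures in `C`, so cylinders suffice; the injection behind
  -- `condExp_linkColour_cylinder` depends on the cylinder.
  rw [← hmap hC, ← hbind hC]
  congr 1
  refine ext_of_generate_finite _ generateFrom_squareCylinders.symm
    (isPiSystem_squareCylinders (fun _ => MeasurableSpace.isPiSystem_measurableSet)
      fun _ => MeasurableSet.univ) ?_ ?_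
  · intro C hC
    have hCm : MeasurableSet C := by
      rw [← generateFrom_squareCylinders]
      exact MeasurableSpace.measurableSet_generateFrom hC
    rw [hmap hCm, hbind hCm]
    have hE : MeasurableSet (linkColour (k := k) (K := K) u ⁻¹' C) := measurable_linkColour u hCm
    have hae := (condExp_linkColour_cylinder hμ u hC hCm).trans
      (condExp_linkColour_eq_kernel u hQ hCm)
    have hint : Integrable ((linkColour (k := k) (K := K) u ⁻¹' C).indicator
        (fun _ => (1 : ℝ))) μ := (integrable_const 1).indicator hE
    have h1 := setIntegral_condExp (avoidingSigma_le u.1) hint hD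
    rw [setIntegral_congr_ae (g := fun ω => (Q (boundaryColouring (enum u) ω) C).toReal)
      (avoidingSigma_le u.1 _ hD) (hae.mono fun _ h _ => h),
      integral_indicator hE, Measure.restrict_restrict hE,
      integral_toReal (measurable_kernel_boundaryColouring _ hCm).aemeasurable
        (.of_forall fun _ => measure_lt_top _ _)] at h1
    simp only [integral_const, smul_eq_mul, mul_one, measureReal_restrict_apply_univ] at h1
    refine ((ENNReal.toReal_eq_toReal_iff' ?_ (measure_ne_top _ _)).1 h1).symm
    refine ((lintegral_mono (g := fun _ => 1) fun _ => prob_le_one).trans_lt ?_).ne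
    simp
  · rw [hmap MeasurableSet.univ, hbind MeasurableSet.univ]
    simp

/-- By `measure_inter_linkColour` the indicator and the kernel, taken as densities, define the same
measure on `avoidingSigma`, hence give the same integral of `G`. -/
lemma lintegral_mul_indicator_linkColour [Countable S] [∀ i, StandardBorelSpace (K i)]
    (hμ : ∀ φ : S ⊕ ℕ ↪ S ⊕ ℕ, μ.map (pullback φ) = μ) (u : Set.powersetCard S m)
    (hQ : μ.map (simplexColouring (enum u)) = μ.map (boundaryColouring (enum u)) ⊗ₘ Q)
    {G : Colouring K (k + 1) (S ⊕ ℕ) → ENNReal} (hG : Measurable[avoidingSigma k K u.1] G)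
    {C : Set (AuxPalette k K m)} (hC : MeasurableSet C) :
    ∫⁻ ω, (linkColour u ⁻¹' C).indicator 1 ω * G ω ∂μ =
      ∫⁻ ω, Q (boundaryColouring (enum u) ω) C * G ω ∂μ := by
  have hle : avoidingSigma k K u.1 ≤ MeasurableSpace.pi := avoidingSigma_le u.1
  have hE : MeasurableSet (linkColour (k := k) (K := K) u ⁻¹' C) := measurable_linkColour u hC
  have hq : Measurable fun ω : Colouring K (k + 1) (S ⊕ ℕ) => Q (boundaryColouring (enum u) ω) C :=
    measurable_kernel_boundaryColouring _ hC
  have htrim : (μ.withDensity ((linkColour u ⁻¹' C).indicator 1)).trim hle =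
      (μ.withDensity fun ω => Q (boundaryColouring (enum u) ω) C).trim hle := by
    refine @Measure.ext _ (avoidingSigma k K u.1) _ _ fun D hD => ?_
    rw [trim_measurableSet_eq hle hD, trim_measurableSet_eq hle hD, withDensity_indicator_one hE,
      withDensity_apply _ (hle _ hD), Measure.restrict_apply (hle _ hD), Set.inter_comm]
    exact measure_inter_linkColour hμ u hQ hD hC
  have h := congrArg (fun ν => @lintegral _ (avoidingSigma k K u.1) ν G) htrim
  simp only [lintegral_trim hle hG] at h
  have hG' := hG.mono hle le_rfl
  rwa [lintegral_withDensity_eq_lintegral_mul _ (measurable_one.indicator hE) hG',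
    lintegral_withDensity_eq_lintegral_mul _ hq hG'] at h

/-- Given the auxiliary colours of all sets of size less than `m`, those of finitely many
`m`-sets are independent. -/
lemma lintegral_mul_prod_indicator_linkColour [Countable S] [∀ i, StandardBorelSpace (K i)]
    (hμ : ∀ φ : S ⊕ ℕ ↪ S ⊕ ℕ, μ.map (pullback φ) = μ)
    (hQ : ∀ f : Fin m ↪ S, μ.map (simplexColouring f) = μ.map (boundaryColouring f) ⊗ₘ Q)
    {A : Set.powersetCard S m → Set (AuxPalette k K m)} (hA : ∀ u, MeasurableSet (A u))
    (s : Finset (Set.powersetCard S m)) {G : Colouring (AuxPalette k K) m S → ENNReal}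
    (hG : Measurable G) :
    ∫⁻ ω, G (auxColouring m ω) * ∏ u ∈ s, (linkColour u ⁻¹' A u).indicator 1 ω ∂μ =
      ∫⁻ ω, G (auxColouring m ω) * ∏ u ∈ s, Q (boundaryColouring (enum u) ω) (A u) ∂μ := by
  classical
  induction s using Finset.induction_on generalizing G with
  | empty => simp
  | insert u s hu ih =>
    -- An `m`-set `v ≠ u` cannot contain `u`, so all factors other than the indicator for `u` are
    -- `avoidingSigma`-measurable.
    have hmeas : Measurable[avoidingSigma k K u.1] fun ω =>
        G (auxColouring m ω) * ∏ v ∈ s, (linkColour v ⁻¹' A v).indicator 1 ω := by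
      refine Measurable.mul (hG.comp (measurable_auxColouring_avoidingSigma u)) ?_
      refine Finset.measurable_fun_prod _ fun v hv => ?_
      refine Measurable.indicator
        (@measurable_const _ _ _ (avoidingSigma k K u.1) 1) ?_
      refine measurable_linkColour_avoidingSigma (fun h => hu ?_) (hA v)
      rwa [Set.powersetCard.eq_iff_subset.2 h]
    -- Once the indicator for `u` is replaced by its kernel, that factor depends only on smaller
    -- sets and is absorbed into `G`; hence the induction over general `G`.
    have hG' : Measurable fun z : Colouring (AuxPalette k K) m S =>
        Q (pullback (enum u) z) (A u) * G z :=
      ((Q.measurable_coe (hA u)).comp (measurable_pullback _)).mul hG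
    calc ∫⁻ ω, G (auxColouring m ω) *
          ∏ v ∈ insert u s, (linkColour v ⁻¹' A v).indicator 1 ω ∂μ
        = ∫⁻ ω, (linkColour u ⁻¹' A u).indicator 1 ω * (G (auxColouring m ω) *
            ∏ v ∈ s, (linkColour v ⁻¹' A v).indicator 1 ω) ∂μ := by
          refine lintegral_congr fun ω => ?_
          rw [Finset.prod_insert hu, mul_left_comm]
      _ = ∫⁻ ω, Q (boundaryColouring (enum u) ω) (A u) * (G (auxColouring m ω) *
            ∏ v ∈ s, (linkColour v ⁻¹' A v).indicator 1 ω) ∂μ :=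
          lintegral_mul_indicator_linkColour hμ u (hQ _) hmeas (hA u)
      _ = ∫⁻ ω, (fun z : Colouring (AuxPalette k K) m S => Q (pullback (enum u) z) (A u) * G z)
            (auxColouring m ω) * ∏ v ∈ s, (linkColour v ⁻¹' A v).indicator 1 ω ∂μ := by
          refine lintegral_congr fun ω => ?_
          rw [← mul_assoc]
          rfl
      _ = ∫⁻ ω, G (auxColouring m ω) *
            ∏ v ∈ insert u s, Q (boundaryColouring (enum v) ω) (A v) ∂μ := by
          rw [ih hG']
          refine lintegral_congr fun ω => ?_
          rw [Finset.prod_insert hu, mul_left_comm, mul_assoc]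
          rfl

/-- One step of the recipe: given the auxiliary colours of all sets of size less than `m`, those of
the `m`-sets are independent with law `Q`. -/
lemma map_auxColouring_linkColour [Countable S] [∀ i, StandardBorelSpace (K i)]
    (hμ : ∀ φ : S ⊕ ℕ ↪ S ⊕ ℕ, μ.map (pullback φ) = μ)
    (hQ : ∀ f : Fin m ↪ S, μ.map (simplexColouring f) = μ.map (boundaryColouring f) ⊗ₘ Q)
    {X : Type w} [MeasurableSpace X] {π : AuxPalette k K m → X} (hπ : Measurable π)
    [IsMarkovKernel (Q.map π)] :
    μ.map (fun ω => (auxColouring m ω, fun u : Set.powersetCard S m => π (linkColour u ω))) =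
      μ.map (auxColouring m) ⊗ₘ independentKernel S (Q.map π) := by
  have hY : Measurable fun (ω : Colouring K (k + 1) (S ⊕ ℕ)) (u : Set.powersetCard S m) =>
      π (linkColour u ω) := measurable_pi_iff.2 fun u => hπ.comp (measurable_linkColour u)
  have haux := measurable_auxColouring (k := k) (K := K) (S := S) m
  have := Measure.isProbabilityMeasure_map (μ := μ) haux.aemeasurable
  have := Measure.isProbabilityMeasure_map (μ := μ) (haux.prodMk hY).aemeasurable
  refine Measure.ext_prod fun {B C} hB hC => ?_
  have hl : ∀ {C : Set (Set.powersetCard S m → X)}, MeasurableSet C →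
      μ.map (fun ω => (auxColouring m ω, fun u : Set.powersetCard S m => π (linkColour u ω)))
        (B ×ˢ C) = (μ.restrict (auxColouring m ⁻¹' B)).map
          (fun ω u => π (linkColour u ω)) C := fun hC => by
    rw [Measure.map_apply (haux.prodMk hY) (hB.prod hC), Measure.map_apply hY hC,
      Measure.restrict_apply (hY hC), Set.inter_comm]
    rfl
  have hr : ∀ {C : Set (Set.powersetCard S m → X)}, MeasurableSet C →
      (μ.map (auxColouring m) ⊗ₘ independentKernel S (Q.map π)) (B ×ˢ C) =
        ((μ.map (auxColouring m)).restrict B).bind (independentKernel S (Q.map π)) C := fun hC => by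
    rw [Measure.compProd_apply_prod hB hC, Measure.bind_apply hC (Kernel.aemeasurable _)]
  rw [hl hC, hr hC]
  -- With `B` fixed, both sides are measures in `C`, to be compared on cylinders.
  congr 1
  refine ext_of_generate_finite _ generateFrom_squareCylinders.symm
    (isPiSystem_squareCylinders (fun _ => MeasurableSpace.isPiSystem_measurableSet)
      fun _ => MeasurableSet.univ) ?_ ?_
  · rintro _ ⟨s, t, ht, rfl⟩
    simp only [Set.mem_pi, Set.mem_univ, forall_const] at ht
    have hst : MeasurableSet ((s : Set (Set.powersetCard S m)).pi t) :=
      MeasurableSet.pi s.countable_toSet fun u _ => ht u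
    have hind : ∀ z : Colouring (AuxPalette k K) m S,
        independentKernel S (Q.map π) z ((s : Set (Set.powersetCard S m)).pi t) =
          ∏ u ∈ s, Q (pullback (enum u) z) (π ⁻¹' t u) := by
      intro z
      refine (Measure.infinitePi_pi _ fun u _ => ht u).trans ?_
      exact Finset.prod_congr rfl fun u _ => Kernel.map_apply' _ hπ _ (ht u)
    rw [← hr hst, Measure.compProd_apply_prod hB hst, ← hl hst,
      Measure.map_apply (haux.prodMk hY) (hB.prod hst)]
    simp only [hind]
    have hprod : Measurable fun z : Colouring (AuxPalette k K) m S =>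
        ∏ u ∈ s, Q (pullback (enum u) z) (π ⁻¹' t u) :=
      Finset.measurable_fun_prod _ fun u _ =>
        (Q.measurable_coe (hπ (ht u))).comp (measurable_pullback _)
    have key := lintegral_mul_prod_indicator_linkColour hμ hQ (A := fun u => π ⁻¹' t u)
      (fun u => hπ (ht u)) s (G := B.indicator 1) (measurable_one.indicator hB)
    rw [setLIntegral_map hB hprod haux, ← lintegral_indicator (haux hB),
      ← lintegral_indicator_one ((haux.prodMk hY) (hB.prod hst))]
    refine Eq.trans (lintegral_congr fun ω => ?_) (key.trans (lintegral_congr fun ω => ?_))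
    · simp only [Set.indicator, Pi.one_apply, Finset.prod_ite_zero, Finset.prod_const_one]
      simp only [Set.mem_preimage, Set.mem_prod, Set.mem_pi, Finset.mem_coe, ← ite_and, mul_ite,
        mul_one, mul_zero]
      grind
    · by_cases h : auxColouring m ω ∈ B
      · rw [Set.indicator_of_mem h, Set.indicator_of_mem (by exact h), Pi.one_apply, one_mul]
        rfl
      · rw [Set.indicator_of_notMem h, Set.indicator_of_notMem (by exact h), zero_mul]
  · rw [← hl MeasurableSet.univ, ← hr MeasurableSet.univ,
      Measure.compProd_apply_prod hB MeasurableSet.univ,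
      Measure.map_apply (haux.prodMk hY) (hB.prod MeasurableSet.univ)]
    simp only [measure_univ, lintegral_one, Measure.restrict_apply_univ]
    rw [Measure.map_apply haux hB]
    congr 1
    ext ω
    simp

end Aux

/-! ### Assembling the ingredients. -/

section Recipe

lemma extend_last {Z : ℕ → Type u} {m : ℕ} {S : Type v}
    (p : Colouring Z m S × (Set.powersetCard S m → Z m)) : extend p (Fin.last m) = p.2 :=
  Fin.snoc_last (α := fun i : Fin (m + 1) => Set.powersetCard S (i : ℕ) → Z i) p.2 p.1

lemma extend_castSucc {Z : ℕ → Type u} {m : ℕ} {S : Type v}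
    (p : Colouring Z m S × (Set.powersetCard S m → Z m)) (i : Fin m) :
    extend p i.castSucc = p.1 i :=
  Fin.snoc_castSucc (α := fun i : Fin (m + 1) => Set.powersetCard S (i : ℕ) → Z i) p.2 p.1 i

variable {k : ℕ} {K : ℕ → Type u} {S : Type v}

/-- The colour of an `i`-set itself, read off from its auxiliary colour. -/
def baseColour {i : ℕ} (hi : i ≤ k) (z : AuxPalette k K i) : K i := z ⟨∅, hi⟩

lemma baseColour_linkColour (i : Fin (k + 1)) (a : Set.powersetCard S (i : ℕ))
    (ω : Colouring K (k + 1) (S ⊕ ℕ)) :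
    baseColour (Nat.le_of_lt_succ i.2) (linkColour a ω) =
      pullback Function.Embedding.inl ω i a := by
  have : (⟨a.1.disjSum ∅, by simp⟩ : Set.powersetCard (S ⊕ ℕ) (i : ℕ)) =
      Set.powersetCard.map (i : ℕ) Function.Embedding.inl a :=
    Subtype.ext (by simp)
  simp only [pullback, ← this]
  rfl

variable [∀ i, MeasurableSpace (K i)]

lemma measurable_baseColour {i : ℕ} (hi : i ≤ k) :
    Measurable (baseColour hi : AuxPalette k K i → K i) :=
  measurable_pi_apply (⟨∅, hi⟩ : {t : Finset ℕ // i + t.card ≤ k})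

/-- The ingredients given by a choice of symmetric kernels between the auxiliary palettes. -/
noncomputable def auxIngredients [∀ i, StandardBorelSpace (K i)]
    (Q : ∀ m, Kernel (Colouring (AuxPalette k K) m (Fin m)) (AuxPalette k K m))
    [∀ m, IsMarkovKernel (Q m)] (hQ : ∀ m, IsSymmetricKernel (Q m)) : Ingredients k K where
  Z := AuxPalette k K
  μ₀ := Q 0 fun i => i.elim0
  κ i := baseColour i.2.le
  measurable_κ i := measurable_baseColour i.2.le
  P i := Q (i + 1)
  symmetric i := hQ (i + 1)
  Plast := (Q k).map (baseColour le_rfl)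
  isMarkovKernel_last := Kernel.IsMarkovKernel.map _ (measurable_baseColour le_rfl)
  symmetric_last g z := by
    rw [Kernel.map_apply _ (measurable_baseColour le_rfl),
      Kernel.map_apply _ (measurable_baseColour le_rfl), hQ k g z]

variable [∀ i, StandardBorelSpace (K i)]
  {Q : ∀ m, Kernel (Colouring (AuxPalette k K) m (Fin m)) (AuxPalette k K m)}
  [∀ m, IsMarkovKernel (Q m)] (hQ : ∀ m, IsSymmetricKernel (Q m))

lemma kernel_auxIngredients (m : ℕ) : (auxIngredients Q hQ).kernel m = Q m := by
  cases m with
  | zero =>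
    refine Kernel.ext fun z => ?_
    exact congrArg (Q 0) (funext fun i => i.elim0)
  | succ m => rfl

variable {μ : Measure (Colouring K (k + 1) (S ⊕ ℕ))} [IsProbabilityMeasure μ]

lemma auxLaw_auxIngredients [Countable S]
    (hμ : ∀ φ : S ⊕ ℕ ↪ S ⊕ ℕ, μ.map (pullback φ) = μ)
    (hQμ : ∀ m, ∀ f : Fin m ↪ S,
      μ.map (simplexColouring f) = μ.map (boundaryColouring f) ⊗ₘ Q m) (m : ℕ) :
    (auxIngredients Q hQ).auxLaw S m = μ.map (auxColouring m) := by
  induction m with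
  | zero =>
    have : (auxColouring 0 : Colouring K (k + 1) (S ⊕ ℕ) → Colouring (AuxPalette k K) 0 S) =
        fun _ i => i.elim0 := funext fun _ => funext fun i => i.elim0
    rw [this, Measure.map_const, measure_univ, one_smul]
    rfl
  | succ m ih =>
    have : IsMarkovKernel ((Q m).map id) := Kernel.IsMarkovKernel.map _ measurable_id
    have h := map_auxColouring_linkColour hμ (hQμ m) measurable_id
    simp only [Kernel.map_id] at h
    simp only [Ingredients.auxLaw]
    rw [ih]
    simp only [kernel_auxIngredients]
    refine (congrArg (Measure.map extend) h).symm.trans ?_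
    have hF : Measurable fun ω : Colouring K (k + 1) (S ⊕ ℕ) => (auxColouring m ω,
        fun u : Set.powersetCard S m => id (linkColour (k := k) (K := K) u ω)) :=
      (measurable_auxColouring m).prodMk (measurable_pi_iff.2 fun u => measurable_linkColour u)
    refine (Measure.map_map (measurable_extend (Z := AuxPalette k K)) hF).trans ?_
    congr 1
    funext ω i
    induction i using Fin.lastCases with
    | last => exact extend_last _
    | cast i => exact extend_castSucc _ i

lemma recipeLaw_auxIngredients [Countable S]
    (hμ : ∀ φ : S ⊕ ℕ ↪ S ⊕ ℕ, μ.map (pullback φ) = μ)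
    (hQμ : ∀ m, ∀ f : Fin m ↪ S,
      μ.map (simplexColouring f) = μ.map (boundaryColouring f) ⊗ₘ Q m) :
    (auxIngredients Q hQ).recipeLaw S = μ.map (pullback Function.Embedding.inl) := by
  have hb := measurable_baseColour (K := K) (le_refl k)
  have : IsMarkovKernel ((Q k).map (baseColour le_rfl)) := Kernel.IsMarkovKernel.map _ hb
  -- For a `k`-set only `t = ∅` is allowed, so `baseColour` merely identifies the auxiliary palette
  -- of rank `k` with `K k`.
  have h := map_auxColouring_linkColour hμ (hQμ k) hb
  simp only [Ingredients.recipeLaw]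
  rw [auxLaw_auxIngredients hQ hμ hQμ]
  refine (congrArg (Measure.map ((auxIngredients Q hQ).output S)) h).symm.trans ?_
  have hF : Measurable fun ω : Colouring K (k + 1) (S ⊕ ℕ) => (auxColouring k ω,
      fun u : Set.powersetCard S k => baseColour le_rfl (linkColour (k := k) (K := K) u ω)) :=
    (measurable_auxColouring k).prodMk
      (measurable_pi_iff.2 fun u => hb.comp (measurable_linkColour u))
  refine (Measure.map_map (Ingredients.measurable_output (auxIngredients Q hQ) S) hF).trans ?_
  congr 1
  funext ω i
  induction i using Fin.lastCases with
  | last =>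
    funext a
    rw [← baseColour_linkColour]
    exact congrFun (extend_last _) a
  | cast i =>
    funext a
    rw [← baseColour_linkColour]
    exact congrFun (extend_castSucc _ i) a

end Recipe

end ExchHypergraph

theorem theorem3p10 (k : ℕ) (hk : 1 ≤ k) (K : ℕ → Type*) [∀ i, MeasurableSpace (K i)]
    [∀ i, StandardBorelSpace (K i)] (S : Type*) [Countable S] [Infinite S]
    (μ : Measure (ExchHypergraph.Colouring K (k + 1) S)) (hμ : ExchHypergraph.IsExchangeable μ) :
    ∃ I : ExchHypergraph.Ingredients k K, I.recipeLaw S = μ := by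
  open ExchHypergraph in
  have := hμ.isProbabilityMeasure
  obtain ⟨e⟩ : Nonempty (S ⊕ ℕ ≃ S) := nonempty_equiv_of_countable
  let ν : Measure (Colouring K (k + 1) (S ⊕ ℕ)) := μ.map (pullback e.toEmbedding)
  have : IsProbabilityMeasure ν :=
    Measure.isProbabilityMeasure_map (measurable_pullback _).aemeasurable
  have hinl : ν.map (pullback Function.Embedding.inl) = μ := by
    rw [Measure.map_map (measurable_pullback _) (measurable_pullback _)]
    refine Eq.trans ?_ (hμ.map_pullback (Function.Embedding.inl.trans e.toEmbedding))
    congr 1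
    funext ω
    exact pullback_pullback _ _ ω
  have hν : ∀ φ : S ⊕ ℕ ↪ S ⊕ ℕ, ν.map (pullback φ) = ν := by
    intro φ
    rw [Measure.map_map (measurable_pullback _) (measurable_pullback _)]
    -- Conjugating `φ` by `e` turns it into an injection of `S` into itself, under which `μ` is
    -- invariant.
    conv_rhs => rw [show ν = μ.map (pullback e.toEmbedding) from rfl,
      ← hμ.map_pullback (e.symm.toEmbedding.trans (φ.trans e.toEmbedding)),
      Measure.map_map (measurable_pullback _) (measurable_pullback _)]
    congr 1
    funext ω
    simp only [Function.comp_apply, pullback_pullback]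
    congr 1
    ext x
    simp
  choose Q hM hsymm hQ using fun m => exists_symmetric_kernel hν m
  exact ⟨auxIngredients Q hsymm, (recipeLaw_auxIngredients hsymm hν hQ).trans hinl⟩
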